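/- \textbf{Setting.} Let $\mathcal S,\mathcal A$ be finite sets with $S=|\mathcal S|$, $A=|\mathcal A|$. A continuous-time Markov decision process $\mathcal M$ with horizon $H\in(0,\infty)$ and initial state $x_0\in\mathcal S$ is given by reward rates $r(x,a)\in[0,1]$, holding-time rates $\lambda(x,a)\in[\lambda_{\min},\lambda_{\max}]$, where $0<\lambda_{\min}\le\lambda_{\max}<\infty$, and transition probabilities $p(\cdot|x,a)$ on $\mathcal S$. It is played for $K\ge 2$ episodes. In episode $k$ the trajectory is $(x_n^k,a_n^k,\tau_n^k)_{n\ge0}$ (states, actions, holding times), with $x_0^k=x_0$, jump times $t_n^k=\sum_{i<n}\tau_i^k$ and actions $a_n^k=\pi^k(x_n^k,(H-t_n^k)^+)$, where the policy $\pi^k$ is computed from the data of episodes $1,\dots,k-1$; given all earlier episodes and the current episode up to the choice of $a_n^k$, the probability that $\tau_n^k\le t$ and $x_{n+1}^k=y$ is $(1-e^{-\lambda(x_n^k,a_n^k)t})\,p(y|x_n^k,a_n^k)$ for all $t\ge0$, $y\in\mathcal S$. \textbf{CT-UCBVI} (inputs $\delta\in(0,1)$, $\epsilon_k\in(0,1)$,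 $\lambda_{\max}$, $r$, $H$, $K$). Put $$N^k(x,a,y)=\sum_{n\ge0}\sum_{l=1}^{k-1}1_{\{(x_n^l,a_n^l,x_{n+1}^l)=(x,a,y)\}}1_{\{t_{n+1}^l\le H\}},\qquad N^{k,+}(x,a)=\sum_{n\ge0}\sum_{l=1}^{k-1}1_{\{(x_n^l,a_n^l)=(x,a)\}}1_{\{t_{n+1}^l\le H\}},$$ $$T^k(x,a)=\sum_{n\ge0}\sum_{l=1}^{k-1}\min\{\tau_n^l,H-t_n^l\}\,1_{\{(x_n^l,a_n^l)=(x,a)\}}1_{\{t_n^l\le H\}},$$ $\hat p_k(y|x,a)=N^k(x,a,y)/\max\{1,N^{k,+}(x,a)\}$, $\hat\lambda_k(x,a)=\min\{N^{k,+}(x,a)/T^k(x,a),\lambda_{\max}\}$ (and $\hat\lambda_k(x,a)=0$ if $T^k(x,a)=0$), $L=4\ln(2SAK/\delta)$, and $$b^k(x,a)=\Big(\tfrac{\lambda_{\max}}{1-e^{-\lambda_{\max}H}}\vee1\Big)\Big(H^2\sqrt{\tfrac{\lambda_{\max}L}{\max\{T^k(x,a),L/\lambda_{\max}\}}}+H\sqrt{\tfrac{2[S\ln2+\ln(SAHK^2/\delta)]}{\max\{1,N^{k,+}(x,a)\}}}\Big)$$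 (the square root of a negative number being read as $0$). For $u:\mathcal S\times[0,H]\to\mathbb R$ let $$(\mathcal T^{a,k}u)(x,t)=[r(x,a)+b^k(x,a)]\int_0^te^{-\hat\lambda_k(x,a)s}ds+\sum_y\int_0^t\hat\lambda_k(x,a)e^{-\hat\lambda_k(x,a)s}u(y,t-s)\hat p_k(y|x,a)\,ds .$$ Let $V_0=0$, $V_{n+1}(x,t)=\min\{t,\max_a(\mathcal T^{a,k}V_n)(x,t)\}$, let $n_k\ge1$ be the first $n\ge1$ with $\|V_n-V_{n-1}\|_\infty<\epsilon_k$ (supremum norm on $\mathcal S\times[0,H]$), and $\hat V^k=V_{n_k}$. In episode $k$ the algorithm plays a policy $\pi^k(x,t)\in\arg\max_a(\mathcal T^{a,k}\hat V^k)(x,t)$, $(x,t)\in\mathcal S\times[0,H]$. \textbf{Proposition.} Under CT-UCBVI, for every $K\ge2$, $$\mathbb E\Big[\sum_{k=1}^K\sum_{m=0}^\infty\frac{(H-t_m^k)^+}{\sqrt{\max\{1,N^{k,+}(x_m^k,a_m^k)\}}}\Big]\le 3\Big(H+\frac1{\lambda_{\min}}\Big)\sqrt{SAK}\;\frac{(\lambda_{\max}H+1)\ln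 K}{\ln(\ln K+1)} .$$ -/

import Mathlib

open MeasureTheory

namespace EpisodicCTMDP

noncomputable section

/-- A tabular finite-horizon continuous-time Markov decision process: reward rates `r(x, a)`,
holding-time rates `λ(x, a)`, jump probabilities `p(y | x, a)`, horizon `H`, initial state `x₀`.
Self-jumps `p(x | x, a) > 0` are allowed (absorbing states). -/
structure CTMDP (S A : Type*) [Fintype S] where
  reward : S → A → ℝ
  rate : S → A → ℝ
  p : S → A → S → ℝ
  horizon : ℝ
  x₀ : S
  horizon_pos : 0 < horizon
  p_nonneg : ∀ x a y, 0 ≤ p x a y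
  p_sum : ∀ x a, ∑ y, p x a y = 1

/-- Standing assumption: holding-time rates lie in `[lamMin, lamMax] ⊆ (0, ∞)` and
reward rates lie in `[0, 1]`. -/
structure CTMDP.Bounded {S A : Type*} [Fintype S] (M : CTMDP S A) (lamMin lamMax : ℝ) : Prop where
  lamMin_pos : 0 < lamMin
  lamMax_pos : 0 < lamMax
  le_rate : ∀ x a, lamMin ≤ M.rate x a
  rate_le : ∀ x a, M.rate x a ≤ lamMax
  reward_nonneg : ∀ x a, 0 ≤ M.reward x a
  reward_le_one : ∀ x a, M.reward x a ≤ 1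

/-- The trajectory of one episode: states `xₙ`, actions `aₙ` and holding times `τₙ`, `n ≥ 0`. -/
structure Trajectory (S A : Type*) where
  state : ℕ → S
  action : ℕ → A
  hold : ℕ → ℝ

/-- The `n`-th jump time `tₙ = τ₀ + ⋯ + τₙ₋₁` (so `t₀ = 0`). -/
def Trajectory.jumpTime {S A : Type*} (T : Trajectory S A) (n : ℕ) : ℝ :=
  ∑ i ∈ Finset.range n, T.hold i

/-- What the algorithm is given: the number of episodes, the horizon, the bound on the rates, the
reward function, the confidence parameter, and the accuracies. Episodes are numbered from `0`, so
`eps k` is the accuracy of the `(k+1)`-st episode. Neither `λ(x, a)` nor `p(y | x, a)` is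
part of it. -/
structure AlgInput (S A : Type*) where
  K : ℕ
  H : ℝ
  lamMax : ℝ
  reward : S → A → ℝ
  delta : ℝ
  eps : ℕ → ℝ

section Algorithm

variable {S A : Type*} {k : ℕ}

open Classical in
/-- Observed number of transitions `(x, a, y)` in the `k` past episodes `D`. -/
def transCount (H : ℝ) (D : Fin k → Trajectory S A) (x : S) (a : A) (y : S) : ℝ :=
  ∑' n : ℕ, ∑ l : Fin k,
    if (D l).state n = x ∧ (D l).action n = a ∧ (D l).state (n + 1) = y ∧
        (D l).jumpTime (n + 1) ≤ H then 1 else 0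

open Classical in
/-- `N⁺(x, a)`: number of visits to `(x, a)` in the `k` past episodes `D` whose next state is
observed by time `H`. -/
def visitCount (H : ℝ) (D : Fin k → Trajectory S A) (x : S) (a : A) : ℝ :=
  ∑' n : ℕ, ∑ l : Fin k,
    if (D l).state n = x ∧ (D l).action n = a ∧ (D l).jumpTime (n + 1) ≤ H then 1 else 0

open Classical in
/-- `T(x, a)`: total time spent at `(x, a)` in the `k` past episodes `D`, the last holding
time of each episode being truncated at `H`. -/
def occTime (H : ℝ) (D : Fin k → Trajectory S A) (x : S) (a : A) : ℝ :=
  ∑' n : ℕ, ∑ l : Fin k,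
    if (D l).state n = x ∧ (D l).action n = a ∧ (D l).jumpTime n ≤ H then
      min ((D l).hold n) (H - (D l).jumpTime n) else 0

/-- Empirical transition probabilities; they vanish when there is no observed transition. -/
def empTrans (H : ℝ) (D : Fin k → Trajectory S A) (x : S) (a : A) (y : S) : ℝ :=
  transCount H D x a y / max 1 (visitCount H D x a)

/-- Empirical holding-time rate truncated at `lamMax`; it is `0` when `(x, a)` was not sampled
(division by zero gives zero). -/
def empRate (I : AlgInput S A) (D : Fin k → Trajectory S A) (x : S) (a : A) : ℝ :=
  min (visitCount I.H D x a / occTime I.H D x a) I.lamMax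

/-- `L(δ) = 4 ln (2 S A K / δ)`. -/
def logFactor [Fintype S] [Fintype A] (I : AlgInput S A) : ℝ :=
  4 * Real.log (2 * Fintype.card S * Fintype.card A * I.K / I.delta)

/-- The exploration bonus. -/
def bonus [Fintype S] [Fintype A] (I : AlgInput S A) (D : Fin k → Trajectory S A)
    (x : S) (a : A) : ℝ :=
  max (I.lamMax / (1 - Real.exp (-I.lamMax * I.H))) 1 *
    (I.H ^ 2 * √(I.lamMax * logFactor I / max (occTime I.H D x a) (logFactor I / I.lamMax)) +
      I.H * √(2 * (Fintype.card S * Real.log 2 +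
        Real.log (Fintype.card S * Fintype.card A * I.H * I.K ^ 2 / I.delta)) /
          max 1 (visitCount I.H D x a)))

/-- The Bellman operator for action `a` of the empirical CTMDP with reward increased by the
bonus. -/
def bellman [Fintype S] [Fintype A] (I : AlgInput S A) (D : Fin k → Trajectory S A)
    (a : A) (u : S → ℝ → ℝ) (x : S) (t : ℝ) : ℝ :=
  (I.reward x a + bonus I D x a) * (∫ s in (0 : ℝ)..t, Real.exp (-empRate I D x a * s)) +
    ∑ y, ∫ s in (0 : ℝ)..t,
      empRate I D x a * Real.exp (-empRate I D x a * s) * u y (t - s) * empTrans I.H D x a y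

/-- Modified value iteration: `V₀ = 0`, `Vₙ₊₁(x, t) = min {t, max_a (𝒯ᵃ Vₙ)(x, t)}`. Only the
values for `t ∈ [0, H]` matter. -/
def valueIter [Fintype S] [Fintype A] (I : AlgInput S A) (D : Fin k → Trajectory S A) :
    ℕ → S → ℝ → ℝ
  | 0 => fun _ _ => 0
  | n + 1 => fun x t => min t (⨆ a, bellman I D a (valueIter I D n) x t)

/-- The first iteration `n ≥ 1` with `‖Vₙ - Vₙ₋₁‖_∞ < ε`, the norm being the supremum norm on
`S × [0, H]`. -/
def stopIndex [Fintype S] [Fintype A] (I : AlgInput S A) (D : Fin k → Trajectory S A) : ℕ :=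
  sInf {n : ℕ | 1 ≤ n ∧
    (⨆ z : S × Set.Icc (0 : ℝ) I.H,
      |valueIter I D n z.1 z.2 - valueIter I D (n - 1) z.1 z.2|) < I.eps k}

/-- The value function returned by the modified value iteration. -/
def valueHat [Fintype S] [Fintype A] (I : AlgInput S A) (D : Fin k → Trajectory S A) :
    S → ℝ → ℝ :=
  valueIter I D (stopIndex I D)

/-- A learning algorithm: from the `k` completed episodes it computes the policy, a map from
(state, remaining time) to actions, that is executed in the next episode. -/
abbrev Algorithm (S A : Type*) : Type _ :=
  (k : ℕ) → (Fin k → Trajectory S A) → S → ℝ → A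

/-- The algorithm is CT-UCBVI (with some way of breaking ties in the `arg max`): its policies
maximise `a ↦ (𝒯ᵃ V̂)(x, t)`. -/
def IsCTUCBVI [Fintype S] [Fintype A] (I : AlgInput S A) (π : Algorithm S A) : Prop :=
  ∀ k < I.K, ∀ (D : Fin k → Trajectory S A) (x : S), ∀ t ∈ Set.Icc (0 : ℝ) I.H, ∀ a : A,
    bellman I D a (valueHat I D) x t ≤ bellman I D (π k D x t) (valueHat I D) x t

end Algorithm

section RandomRun

variable {S A Ω : Type*} [MeasurableSpace S] [MeasurableSpace A]

/-- The data of the episodes before episode `k` (episodes are numbered from `0`). -/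
def past (Z : ℕ → Ω → Trajectory S A) (k : ℕ) (ω : Ω) : Fin k → Trajectory S A :=
  fun l => Z l ω

/-- The history just after the `n`-th decision of episode `k`: all earlier episodes, and
`x₀, a₀, τ₀, …, xₙ₋₁, aₙ₋₁, τₙ₋₁, xₙ, aₙ` of episode `k`. -/
abbrev history (Z : ℕ → Ω → Trajectory S A) (k n : ℕ) : MeasurableSpace Ω :=
  (⨆ (l : ℕ) (_ : l < k) (i : ℕ),
    MeasurableSpace.comap (fun ω => ((Z l ω).state i, (Z l ω).action i, (Z l ω).hold i))
      inferInstance) ⊔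
  (⨆ (i : ℕ) (_ : i ≤ n),
    MeasurableSpace.comap (fun ω => ((Z k ω).state i, (Z k ω).action i)) inferInstance) ⊔
  (⨆ (i : ℕ) (_ : i < n), MeasurableSpace.comap (fun ω => (Z k ω).hold i) inferInstance)

/-- `Z 0, …, Z (K-1)` are the random trajectories of `K` episodes of the CTMDP `M` played with the
learning algorithm `π`: every episode starts in `x₀`; the `n`-th action is the one dictated by
the policy of the episode at the current state and remaining time `(H - tₙ)⁺`; and, given the
history up to that action, the holding time is at most `t` and the next state is `y` with
probability `(1 - exp (-λ(xₙ, aₙ) t)) p(y | xₙ, aₙ)`. -/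
structure IsRun [Fintype S] [MeasurableSpace Ω] (M : CTMDP S A) (π : Algorithm S A) (K : ℕ)
    (μ : Measure Ω) (Z : ℕ → Ω → Trajectory S A) : Prop where
  measurable_state : ∀ k < K, ∀ n, Measurable fun ω => (Z k ω).state n
  measurable_action : ∀ k < K, ∀ n, Measurable fun ω => (Z k ω).action n
  measurable_hold : ∀ k < K, ∀ n, Measurable fun ω => (Z k ω).hold n
  init : ∀ k < K, ∀ᵐ ω ∂μ, (Z k ω).state 0 = M.x₀
  action_eq : ∀ k < K, ∀ n, ∀ᵐ ω ∂μ, (Z k ω).action n =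
    π k (past Z k ω) ((Z k ω).state n) (max (M.horizon - (Z k ω).jumpTime n) 0)
  law : ∀ k < K, ∀ n, ∀ t : ℝ, 0 ≤ t → ∀ y : S,
    μ[Set.indicator {ω | (Z k ω).hold n ≤ t ∧ (Z k ω).state (n + 1) = y} (fun _ => (1 : ℝ)) |
        history Z k n] =ᵐ[μ]
      fun ω => (1 - Real.exp (-M.rate ((Z k ω).state n) ((Z k ω).action n) * t)) *
        M.p ((Z k ω).state n) ((Z k ω).action n) y

end RandomRun

end

end EpisodicCTMDP

/-! Write `c = lamMax * H`, `u = ln K`, and call a jump observed if it occurs by time `H`. The proof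
trades remaining time for observed jumps, bounds their weighted number path by path, and averages
with an exponential moment.

At a decision at time `t`, the next jump is observed with conditional probability `1 - exp (-λ (H -
t)⁺)`, which times `H + 1 / lamMin` dominates `(H - t)⁺`. The weight `1 / √(max 1 N)` is known at
that time, so `(H - t)⁺` may be replaced by the indicator of an observed jump
(`lintegral_remaining_mul_le`).

The counts are frozen during an episode, so the usual telescoping of square roots for one pair `(x,
a)` costs a factor `√(1 + η)`, where `η` bounds the observed jumps of any episode. A weighted AM-GM
inequality makes the bound linear in `η` and in the total number of jumps
(`sum_jump_div_sqrt_visitCount_le`).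

As for a Poisson variable of mean `c`, the expectation of `2 ^ (observed jumps)` is at most `exp c`
(`lintegral_iSup_prod_jump_le`). Tangent lines of the exponential then give at most `c / ln 2` jumps
per episode on average, and at most `(u + c) / ln 2` for the mean of the maximum over `K` episodes.
The inequality `√(1 + u) ≤ u / ln (u + 1)` produces the stated form. -/

namespace EpisodicCTMDP

open ProbabilityTheory

/-! ### The exponential distribution -/

theorem expMeasure_Iic {r : ℝ} (hr : 0 < r) (t : ℝ) :
    expMeasure r (Set.Iic t) = ENNReal.ofReal (if 0 ≤ t then 1 - Real.exp (-(r * t)) else 0) := by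
  have := isProbabilityMeasure_expMeasure hr
  rw [← ofReal_cdf, cdf_expMeasure_eq hr]

theorem measurable_exponentialPDF (r : ℝ) : Measurable (exponentialPDF r) :=
  (measurable_exponentialPDFReal r).ennreal_ofReal

theorem lintegral_expMeasure {r : ℝ} {f : ℝ → ENNReal} (hf : Measurable f) {s : Set ℝ}
    (hs : MeasurableSet s) :
    ∫⁻ t in s, f t ∂expMeasure r = ∫⁻ t in s, exponentialPDF r t * f t := by
  unfold expMeasure gammaMeasure
  change ∫⁻ t in s, f t ∂(volume.withDensity (exponentialPDF r)) = _
  rw [restrict_withDensity hs, 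
    lintegral_withDensity_eq_lintegral_mul _ (measurable_exponentialPDF r) hf]
  rfl

theorem ae_expMeasure_pos {r : ℝ} (hr : 0 < r) : ∀ᵐ s ∂expMeasure r, 0 < s := by
  have h : expMeasure r (Set.Iic 0) = 0 := by simp [expMeasure_Iic hr]
  rw [ae_iff]
  convert h using 2
  ext; simp

/-- One step of the exponential supermartingale for the number of jumps. -/
theorem lintegral_expMeasure_jump_le {r b : ℝ} (hr : 0 < r) (hrb : r ≤ b) (h : ℝ) :
    ∫⁻ s, (if s ≤ h then 2 else 1) * ENNReal.ofReal (Real.exp (b * max (h - s) 0)) ∂expMeasure r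
      ≤ ENNReal.ofReal (Real.exp (b * max h 0)) := by
  have := isProbabilityMeasure_expMeasure hr
  have hb : 0 < b := hr.trans_le hrb
  rcases lt_or_ge h 0 with hh | hh
  -- Past the horizon, almost surely `s > 0 > h`: no jump is counted and the exponential weight is
  -- `1`.
  · calc _ = ∫⁻ s, 1 ∂expMeasure r := by
          apply lintegral_congr_ae
          filter_upwards [ae_expMeasure_pos hr] with s hs
          rw [if_neg (by linarith), max_eq_right (by linarith)]
          simp
      _ ≤ _ := by simp [max_eq_right hh.le]
  · have hm : Measurable fun s : ℝ =>
        (if s ≤ h then 2 else 1) * ENNReal.ofReal (Real.exp (b * max (h - s) 0)) := by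
      apply Measurable.mul
      · exact Measurable.ite measurableSet_Iic measurable_const measurable_const
      · fun_prop
    rw [← lintegral_add_compl _ (measurableSet_Iic (a := h)),
      lintegral_expMeasure hm measurableSet_Iic]
    -- Multiplying the density `r exp (-r s)` by `exp (b (h - s))` gives a multiple of the
    -- exponential density of rate `r + b`.
    have h1 : ∫⁻ s in Set.Iic h, exponentialPDF r s *
        ((if s ≤ h then 2 else 1) * ENNReal.ofReal (Real.exp (b * max (h - s) 0)))
        = ENNReal.ofReal (2 * r / (r + b) * Real.exp (b * h)) *
          ENNReal.ofReal (1 - Real.exp (-((r + b) * h))) := by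
      have h0 := lintegral_exponentialPDF_eq_antiDeriv (r := r + b) (by linarith) h
      rw [if_pos hh] at h0
      rw [← h0, ← lintegral_const_mul _ (measurable_exponentialPDF _)]
      apply setLIntegral_congr_fun measurableSet_Iic
      intro s hs
      simp only [Set.mem_Iic] at hs
      simp only [exponentialPDF_eq, if_pos hs]
      rw [max_eq_left (by linarith)]
      split_ifs with h2
      · rw [show (2 : ENNReal) = ENNReal.ofReal 2 by simp, ← ENNReal.ofReal_mul (by norm_num),
          ← ENNReal.ofReal_mul (by positivity), ← ENNReal.ofReal_mul (by positivity)]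
        congr 1
        have : r + b ≠ 0 := by positivity
        rw [show b * (h - s) = b * h + -(b * s) by ring, Real.exp_add,
          show -((r + b) * s) = -(r * s) + -(b * s) by ring, Real.exp_add]
        field_simp
      · simp
    have h2 : ∫⁻ s in (Set.Iic h)ᶜ,
        (if s ≤ h then 2 else 1) * ENNReal.ofReal (Real.exp (b * max (h - s) 0)) ∂expMeasure r
        = ENNReal.ofReal (Real.exp (-(r * h))) := by
      rw [setLIntegral_congr_fun (g := fun _ => 1) measurableSet_Iic.compl]
      · rw [setLIntegral_one, prob_compl_eq_one_sub measurableSet_Iic, expMeasure_Iic hr,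
          if_pos hh, show (1 : ENNReal) = ENNReal.ofReal 1 by simp,
          ← ENNReal.ofReal_sub _ (by simp; positivity)]
        congr 1; ring
      · intro s hs
        simp only [Set.mem_compl_iff, Set.mem_Iic, not_le] at hs
        simp only
        rw [if_neg (by linarith), max_eq_right (by linarith)]
        simp
    have h3 : 0 ≤ 1 - Real.exp (-((r + b) * h)) := by
      simp; positivity
    rw [h1, h2, ← ENNReal.ofReal_mul (by positivity), ← ENNReal.ofReal_add (by positivity)
      (by positivity), max_eq_left hh]
    apply ENNReal.ofReal_le_ofReal
    have h4 : Real.exp (b * h) * Real.exp (-((r + b) * h)) = Real.exp (-(r * h)) := by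
      rw [← Real.exp_add]; congr 1; ring
    have h5 : Real.exp (-(r * h)) ≤ Real.exp (b * h) := by
      apply Real.exp_le_exp.2; nlinarith
    -- Here `r ≤ b` enters: with `θ = 2 r / (r + b) ≤ 1` the total is `θ exp (b h) + (1 - θ) exp (-r
    -- h)`, a convex combination whose larger endpoint is `exp (b h)`.
    have h6 : 2 * r / (r + b) ≤ 1 := by rw [div_le_one (by positivity)]; linarith
    have : 2 * r / (r + b) * Real.exp (b * h) * (1 - Real.exp (-((r + b) * h)))
      = 2 * r / (r + b) * (Real.exp (b * h) - Real.exp (-(r * h))) := by rw [← h4]; ring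
    rw [this]
    nlinarith

/-- From `1 + r u ≤ exp (r u)` one gets `1 - exp (-r u) ≥ r u / (1 + r u)`, and `u = (u + 1 / r) *
(r u / (1 + r u))`. -/
theorem self_le_mul_one_sub_exp {u H r : ℝ} (hu : 0 ≤ u) (huH : u ≤ H) (hr : 0 < r) :
    u ≤ (H + 1 / r) * (1 - Real.exp (-(r * u))) := by
  have h1 : 1 + r * u ≤ Real.exp (r * u) := by linarith [Real.add_one_le_exp (r * u)]
  have hru : 0 ≤ r * u := by positivity
  have h2 : Real.exp (-(r * u)) ≤ 1 / (1 + r * u) := by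
    rw [Real.exp_neg, ← one_div]
    exact one_div_le_one_div_of_le (by positivity) h1
  calc u = (u + 1 / r) * (1 - 1 / (1 + r * u)) := by field_simp; ring
    _ ≤ (u + 1 / r) * (1 - Real.exp (-(r * u))) := by gcongr
    _ ≤ _ := by
      have : 0 ≤ 1 - Real.exp (-(r * u)) := by simp; positivity
      gcongr

theorem ofReal_le_mul_expMeasure_Iic {t H r lamMin : ℝ} (ht : 0 ≤ t) (hl : 0 < lamMin)
    (hr : lamMin ≤ r) :
    ENNReal.ofReal (max (H - t) 0)
      ≤ ENNReal.ofReal (H + 1 / lamMin) * expMeasure r (Set.Iic (H - t)) := by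
  rcases lt_or_ge (H - t) 0 with h | h
  · simp [max_eq_right h.le]
  · have hH : 0 ≤ H := by linarith
    rw [expMeasure_Iic (hl.trans_le hr), if_pos h, max_eq_left h,
      ← ENNReal.ofReal_mul (by positivity)]
    apply ENNReal.ofReal_le_ofReal
    refine (self_le_mul_one_sub_exp h (by linarith) hl).trans ?_
    gcongr

/-! ### Freezing lemma -/

/-- If, on the event `E`, the conditional law of `τ` given `m` is exponential of rate `r`, then an
`m`-measurable variable may be frozen when integrating with respect to `τ`. -/
theorem setLIntegral_comp_eq_of_exp {Ω β : Type*} [MeasurableSpace β] {m m0 : MeasurableSpace Ω}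
    (hm : m ≤ m0) (μ : Measure Ω) [IsFiniteMeasure μ] {τ : Ω → ℝ} (hτ : Measurable τ) {r : ℝ}
    (hr : 0 < r) {E : Set Ω} (hE : MeasurableSet[m] E)
    (h : ∀ t, 0 ≤ t → ∀ B, MeasurableSet[m] B → B ⊆ E →
      μ (B ∩ {ω | τ ω ≤ t}) = μ B * ENNReal.ofReal (1 - Real.exp (-(r * t))))
    {Y : Ω → β} (hY : Measurable[m] Y) {g : β × ℝ → ENNReal} (hg : Measurable g) :
    ∫⁻ ω in E, g (Y ω, τ ω) ∂μ = ∫⁻ ω in E, ∫⁻ s, g (Y ω, s) ∂expMeasure r ∂μ := by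
  have := isProbabilityMeasure_expMeasure hr
  have hY0 : Measurable Y := hY.mono hm le_rfl
  have key : ∀ B, MeasurableSet[m] B → B ⊆ E → ∀ s, MeasurableSet s →
      μ (B ∩ τ ⁻¹' s) = μ B * expMeasure r s := by
    intro B hB hBE s hs
    have heq : (μ.restrict B).map τ = μ B • expMeasure r := by
      have : IsFiniteMeasure (μ B • expMeasure r) := by
        constructor; simp
      apply Measure.ext_of_Iic
      intro t
      rw [Measure.map_apply hτ measurableSet_Iic, Measure.restrict_apply (hτ measurableSet_Iic),
        Measure.smul_apply, expMeasure_Iic hr, smul_eq_mul, Set.inter_comm]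
      split_ifs with ht
      · exact h t ht B hB hBE
      -- The hypothesis covers only `t ≥ 0`; a negative threshold is contained in the null event `τ
      -- ≤ 0`.
      · have h0 := h 0 le_rfl B hB hBE
        simp only [mul_zero, neg_zero, Real.exp_zero, sub_self, ENNReal.ofReal_zero] at h0 ⊢
        refine measure_mono_null (Set.inter_subset_inter_right _ ?_) h0
        intro ω hω
        simp only [Set.mem_preimage, Set.mem_Iic] at hω
        exact hω.trans (not_le.1 ht).le
    have := congrArg (fun ν => ν s) heq
    simp only [Measure.map_apply hτ hs, Measure.restrict_apply (hτ hs), Measure.smul_apply,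
      smul_eq_mul] at this
    rwa [Set.inter_comm]
  -- Restricted to `E`, the pair `(Y, τ)` has a product law, so the claim becomes Tonelli's theorem.
  have hprod : (μ.restrict E).map (fun ω => (Y ω, τ ω))
      = ((μ.restrict E).map Y).prod (expMeasure r) := by
    symm
    apply Measure.prod_eq
    intro s t hs ht
    rw [Measure.map_apply (hY0.prodMk hτ) (hs.prod ht), Measure.map_apply hY0 hs,
      Measure.restrict_apply ((hY0.prodMk hτ) (hs.prod ht)), Measure.restrict_apply (hY0 hs),
      ← key _ ((hY hs).inter hE) Set.inter_subset_right t ht]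
    congr 1
    ext ω
    simp only [Set.mem_inter_iff, Set.mem_preimage, Set.mem_prod]
    tauto
  have hg' : Measurable fun y => ∫⁻ s, g (y, s) ∂expMeasure r := hg.lintegral_prod_right'
  rw [← lintegral_map hg (hY0.prodMk hτ), hprod, lintegral_prod _ hg.aemeasurable,
    lintegral_map hg' hY0]

/-! ### Measurability with respect to the history at a decision -/

section Measurability

variable {S A Ω : Type*} [MeasurableSpace S] [MeasurableSpace A]
  {Z : ℕ → Ω → Trajectory S A} {k n l i : ℕ}

theorem measurable_history_past (hl : l < k) (i : ℕ) :
    Measurable[history Z k n] fun ω => ((Z l ω).state i, (Z l ω).action i, (Z l ω).hold i) := by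
  refine Measurable.mono (comap_measurable _) ?_ le_rfl
  refine le_sup_of_le_left (le_sup_of_le_left ?_)
  exact le_iSup_of_le l (le_iSup_of_le hl (le_iSup_of_le i le_rfl))

theorem measurable_history_past_state (hl : l < k) (i : ℕ) :
    Measurable[history Z k n] fun ω => (Z l ω).state i :=
  measurable_fst.comp (measurable_history_past hl i)

theorem measurable_history_past_action (hl : l < k) (i : ℕ) :
    Measurable[history Z k n] fun ω => (Z l ω).action i :=
  (measurable_fst.comp measurable_snd).comp (measurable_history_past hl i)

theorem measurable_history_past_hold (hl : l < k) (i : ℕ) :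
    Measurable[history Z k n] fun ω => (Z l ω).hold i :=
  (measurable_snd.comp measurable_snd).comp (measurable_history_past hl i)

theorem measurable_history_past_jumpTime (hl : l < k) (i : ℕ) :
    Measurable[history Z k n] fun ω => (Z l ω).jumpTime i := by
  unfold Trajectory.jumpTime
  exact Finset.measurable_sum _ fun j _ => measurable_history_past_hold hl j

theorem measurable_history_state_action (hi : i ≤ n) :
    Measurable[history Z k n] fun ω => ((Z k ω).state i, (Z k ω).action i) := by
  refine Measurable.mono (comap_measurable _) ?_ le_rfl
  refine le_sup_of_le_left (le_sup_of_le_right ?_)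
  exact le_iSup_of_le i (le_iSup_of_le hi le_rfl)

theorem measurable_history_hold (hi : i < n) :
    Measurable[history Z k n] fun ω => (Z k ω).hold i := by
  refine Measurable.mono (comap_measurable _) ?_ le_rfl
  exact le_sup_of_le_right (le_iSup_of_le i (le_iSup_of_le hi le_rfl))

theorem measurable_history_jumpTime (hi : i ≤ n) :
    Measurable[history Z k n] fun ω => (Z k ω).jumpTime i := by
  unfold Trajectory.jumpTime
  exact Finset.measurable_sum _ fun j hj =>
    measurable_history_hold ((Finset.mem_range.1 hj).trans_le hi)

theorem measurable_history_visitCount [DiscreteMeasurableSpace S] [DiscreteMeasurableSpace A]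
    (H : ℝ) (x : S) (a : A) :
    Measurable[history Z k n] fun ω => visitCount H (past Z k ω) x a := by
  classical
  let m : MeasurableSpace Ω := history Z k n
  have h : ∀ i, Measurable fun ω => ENNReal.ofReal (∑ l : Fin k,
      if (past Z k ω l).state i = x ∧ (past Z k ω l).action i = a ∧
        (past Z k ω l).jumpTime (i + 1) ≤ H then (1 : ℝ) else 0) := by
    intro i
    apply Measurable.ennreal_ofReal
    refine Finset.measurable_sum _ fun l _ => ?_
    refine Measurable.ite ?_ measurable_const measurable_const
    refine MeasurableSet.inter ?_ (MeasurableSet.inter ?_ ?_)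
    · exact measurable_history_past_state l.2 i (MeasurableSet.of_discrete (s := {x}))
    · exact measurable_history_past_action l.2 i (MeasurableSet.of_discrete (s := {a}))
    · exact measurable_history_past_jumpTime l.2 (i + 1) measurableSet_Iic
  have hs := Measurable.tsum (L := SummationFilter.unconditional ℕ) h
  convert hs.ennreal_toReal using 2 with ω
  -- Nothing is lost in passing through `ENNReal`: a divergent real `tsum` is `0`, and so is `toReal
  -- ⊤`.
  rw [ENNReal.tsum_toReal_eq (fun _ => ENNReal.ofReal_ne_top)]
  unfold visitCount
  congr 1
  ext i
  rw [ENNReal.toReal_ofReal (Finset.sum_nonneg fun _ _ => by split_ifs <;> norm_num)]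

theorem measurable_history_visitCount_current [Finite S] [Finite A]
    [DiscreteMeasurableSpace S] [DiscreteMeasurableSpace A] (H : ℝ) :
    Measurable[history Z k n] fun ω =>
      visitCount H (past Z k ω) ((Z k ω).state n) ((Z k ω).action n) := by
  let m : MeasurableSpace Ω := history Z k n
  have h : Measurable fun q : Ω × (S × A) => visitCount H (past Z k q.1) q.2.1 q.2.2 :=
    measurable_from_prod_countable_left fun q => measurable_history_visitCount H q.1 q.2
  exact h.comp (measurable_id.prodMk (measurable_history_state_action le_rfl))

end Measurability

/-! ### Integrating out a holding time; the exponential moment of the jump count -/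

namespace IsRun

variable {S A Ω : Type*} [Fintype S] [MeasurableSpace S] [MeasurableSpace A] [MeasurableSpace Ω]
  {μ : Measure Ω} {M : CTMDP S A} {lamMin lamMax : ℝ} {K : ℕ} {π : Algorithm S A}
  {Z : ℕ → Ω → Trajectory S A} {k : ℕ}

theorem history_le (hZ : IsRun M π K μ Z) (hk : k < K) (n : ℕ) :
    history Z k n ≤ ‹MeasurableSpace Ω› := by
  refine sup_le (sup_le ?_ ?_) ?_
  · refine iSup_le fun l => iSup_le fun hl => iSup_le fun i => Measurable.comap_le ?_
    have hl' := hl.trans hk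
    exact (hZ.measurable_state l hl' i).prodMk
      ((hZ.measurable_action l hl' i).prodMk (hZ.measurable_hold l hl' i))
  · refine iSup_le fun i => iSup_le fun _ => Measurable.comap_le ?_
    exact (hZ.measurable_state k hk i).prodMk (hZ.measurable_action k hk i)
  · exact iSup_le fun i => iSup_le fun _ => Measurable.comap_le (hZ.measurable_hold k hk i)

theorem measurable_jumpTime (hZ : IsRun M π K μ Z) (hk : k < K) (n : ℕ) :
    Measurable fun ω => (Z k ω).jumpTime n := by
  unfold Trajectory.jumpTime
  exact Finset.measurable_sum _ fun j _ => hZ.measurable_hold k hk j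

variable [IsProbabilityMeasure μ] [DiscreteMeasurableSpace S]

/-- On `B` the rate and transition probabilities are constant, so `law` integrates to a product;
summing over the next state removes `p`. -/
theorem measure_inter_hold_le (hZ : IsRun M π K μ Z) (hM : M.Bounded lamMin lamMax) (hk : k < K)
    (n : ℕ) {x : S} {a : A} {B : Set Ω} (hB : MeasurableSet[history Z k n] B)
    (hBE : B ⊆ {ω | (Z k ω).state n = x ∧ (Z k ω).action n = a}) {t : ℝ} (ht : 0 ≤ t) :
    μ (B ∩ {ω | (Z k ω).hold n ≤ t})
      = μ B * ENNReal.ofReal (1 - Real.exp (-(M.rate x a * t))) := by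
  have hle := hZ.history_le hk n
  have hB0 := hle _ hB
  have hr : 0 < M.rate x a := hM.lamMin_pos.trans_le (hM.le_rate x a)
  have hmeas : ∀ y, MeasurableSet {ω | (Z k ω).hold n ≤ t ∧ (Z k ω).state (n + 1) = y} :=
    fun y => (hZ.measurable_hold k hk n measurableSet_Iic).inter
      (hZ.measurable_state k hk (n + 1) (MeasurableSet.of_discrete (s := {y})))
  have h1 : ∀ y, μ.real (B ∩ {ω | (Z k ω).hold n ≤ t ∧ (Z k ω).state (n + 1) = y})
      = μ.real B * (1 - Real.exp (-(M.rate x a * t))) * M.p x a y := by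
    intro y
    have hint : Integrable (Set.indicator
        {ω | (Z k ω).hold n ≤ t ∧ (Z k ω).state (n + 1) = y} (fun _ => (1 : ℝ))) μ :=
      (integrable_const 1).indicator (hmeas y)
    have h2 := setIntegral_condExp hle hint hB
    rw [setIntegral_congr_ae (g := fun _ => (1 - Real.exp (-(M.rate x a * t))) * M.p x a y) hB0]
      at h2
    · rw [setIntegral_const, setIntegral_indicator (hmeas y), setIntegral_const] at h2
      simp only [smul_eq_mul, mul_one] at h2
      rw [← h2, mul_assoc]
    · filter_upwards [hZ.law k hk n t ht y] with ω hω hωB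
      rw [hω, (hBE hωB).1, (hBE hωB).2, neg_mul]
  have h3 : μ.real (B ∩ {ω | (Z k ω).hold n ≤ t})
      = μ.real B * (1 - Real.exp (-(M.rate x a * t))) := by
    have : B ∩ {ω | (Z k ω).hold n ≤ t}
        = ⋃ y ∈ (Finset.univ : Finset S),
          B ∩ {ω | (Z k ω).hold n ≤ t ∧ (Z k ω).state (n + 1) = y} := by
      ext ω; simp
    rw [this, measureReal_biUnion_finset]
    · simp only [h1]
      rw [← Finset.mul_sum, M.p_sum, mul_one]
    · intro y _ y' _ hyy
      refine Set.disjoint_left.2 fun ω h h' => hyy ?_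
      exact h.2.2.symm.trans h'.2.2
    · exact fun y _ => hB0.inter (hmeas y)
  rw [← ofReal_measureReal, h3, ENNReal.ofReal_mul measureReal_nonneg, ofReal_measureReal]

variable [Fintype A] [DiscreteMeasurableSpace A]

/-- The holding time may be integrated out against the exponential law of the current rate, any
variable known at the time of the decision being frozen. -/
theorem lintegral_hold_eq {β : Type*} [MeasurableSpace β] (hZ : IsRun M π K μ Z)
    (hM : M.Bounded lamMin lamMax) (hk : k < K) (n : ℕ) {Y : Ω → β}
    (hY : Measurable[history Z k n] Y) {g : β × ℝ → ENNReal} (hg : Measurable g) :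
    ∫⁻ ω, g (Y ω, (Z k ω).hold n) ∂μ
      = ∫⁻ ω, ∫⁻ s, g (Y ω, s) ∂expMeasure (M.rate ((Z k ω).state n) ((Z k ω).action n)) ∂μ := by
  have hle := hZ.history_le hk n
  -- The events `E q` partition `Ω` by the current pair; on each of them the rate is a constant and
  -- the freezing lemma applies.
  let E : S × A → Set Ω := fun q => (fun ω => ((Z k ω).state n, (Z k ω).action n)) ⁻¹' {q}
  have hE : ∀ q, MeasurableSet[history Z k n] (E q) := fun q =>
    measurable_history_state_action le_rfl (measurableSet_singleton q)
  have hU : ⋃ q, E q = Set.univ := by ext ω; simp [E]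
  have hd : Pairwise (Function.onFun Disjoint E) := fun q q' h =>
    Disjoint.preimage _ (by simpa using h)
  rw [← setLIntegral_univ, ← setLIntegral_univ (μ := μ) (f := fun ω => ∫⁻ s, _ ∂_), ← hU,
    lintegral_iUnion (fun q => hle _ (hE q)) hd, lintegral_iUnion (fun q => hle _ (hE q)) hd]
  congr 1
  ext q
  have hr : 0 < M.rate q.1 q.2 := hM.lamMin_pos.trans_le (hM.le_rate _ _)
  rw [setLIntegral_comp_eq_of_exp hle μ (hZ.measurable_hold k hk n) hr (hE q) ?_ hY hg]
  · refine setLIntegral_congr_fun (hle _ (hE q)) fun ω hω => ?_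
    have h : ((Z k ω).state n, (Z k ω).action n) = q := hω
    simp only [← h]
  · intro t ht B hB hBE
    refine hZ.measure_inter_hold_le hM hk n hB (fun ω hω => ?_) ht
    have h : ((Z k ω).state n, (Z k ω).action n) = q := hBE hω
    simp [← h]

theorem ae_hold_pos (hZ : IsRun M π K μ Z) (hM : M.Bounded lamMin lamMax) (hk : k < K) (n : ℕ) :
    ∀ᵐ ω ∂μ, 0 < (Z k ω).hold n := by
  have hg : Measurable fun q : Unit × ℝ => Set.indicator (Set.Iic (0 : ℝ)) (1 : ℝ → ENNReal) q.2 :=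
    (measurable_one.indicator measurableSet_Iic).comp measurable_snd
  have h := hZ.lintegral_hold_eq hM hk n (Y := fun _ => ()) measurable_const hg
  have h0 : ∀ ω, ∫⁻ s, Set.indicator (Set.Iic (0 : ℝ)) (1 : ℝ → ENNReal) s
      ∂expMeasure (M.rate ((Z k ω).state n) ((Z k ω).action n)) = 0 := by
    intro ω
    rw [lintegral_indicator_one measurableSet_Iic,
      expMeasure_Iic (hM.lamMin_pos.trans_le (hM.le_rate _ _))]
    simp
  simp only [h0, lintegral_zero] at h
  have hm : Measurable fun ω =>
      Set.indicator (Set.Iic (0 : ℝ)) (1 : ℝ → ENNReal) ((Z k ω).hold n) :=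
    (measurable_one.indicator measurableSet_Iic).comp (hZ.measurable_hold k hk n)
  rw [lintegral_eq_zero_iff hm] at h
  filter_upwards [h] with ω hω
  by_contra hc
  simp [Set.indicator_of_mem (show (Z k ω).hold n ∈ Set.Iic (0 : ℝ) from not_lt.1 hc)] at hω

theorem ae_jumpTime_nonneg (hZ : IsRun M π K μ Z) (hM : M.Bounded lamMin lamMax) (hk : k < K)
    (n : ℕ) : ∀ᵐ ω ∂μ, 0 ≤ (Z k ω).jumpTime n := by
  filter_upwards [ae_all_iff.2 fun i => hZ.ae_hold_pos hM hk i] with ω hω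
  exact Finset.sum_nonneg fun i _ => (hω i).le

/-- The remaining time at a decision is controlled by the probability that the next jump is
observed. -/
theorem lintegral_remaining_mul_le (hZ : IsRun M π K μ Z) (hM : M.Bounded lamMin lamMax)
    (hk : k < K) (n : ℕ) {F : Ω → ENNReal} (hF : Measurable[history Z k n] F) :
    ∫⁻ ω, ENNReal.ofReal (max (M.horizon - (Z k ω).jumpTime n) 0) * F ω ∂μ
      ≤ ENNReal.ofReal (M.horizon + 1 / lamMin) *
        ∫⁻ ω, (if (Z k ω).jumpTime (n + 1) ≤ M.horizon then 1 else 0) * F ω ∂μ := by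
  let g : (ℝ × ENNReal) × ℝ → ENNReal := fun q =>
    (if q.2 ≤ M.horizon - q.1.1 then 1 else 0) * q.1.2
  have hg : Measurable g := by
    refine Measurable.mul (Measurable.ite ?_ measurable_const measurable_const) (by fun_prop)
    exact measurableSet_le (by fun_prop) (by fun_prop)
  have hY : Measurable[history Z k n] fun ω => ((Z k ω).jumpTime n, F ω) :=
    (measurable_history_jumpTime le_rfl).prodMk hF
  have h := hZ.lintegral_hold_eq hM hk n hY hg
  have h1 : ∀ ω, g (((Z k ω).jumpTime n, F ω), (Z k ω).hold n)
      = (if (Z k ω).jumpTime (n + 1) ≤ M.horizon then 1 else 0) * F ω := by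
    intro ω
    simp only [g, Trajectory.jumpTime, Finset.sum_range_succ, le_sub_iff_add_le']
  simp only [h1] at h
  rw [h, ← lintegral_const_mul' _ _ ENNReal.ofReal_ne_top]
  apply lintegral_mono_ae
  filter_upwards [hZ.ae_jumpTime_nonneg hM hk n] with ω hω
  have h2 : ∫⁻ s, g (((Z k ω).jumpTime n, F ω), s)
      ∂expMeasure (M.rate ((Z k ω).state n) ((Z k ω).action n))
      = expMeasure (M.rate ((Z k ω).state n) ((Z k ω).action n))
        (Set.Iic (M.horizon - (Z k ω).jumpTime n)) * F ω := by
    simp only [g]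
    rw [lintegral_mul_const, ← lintegral_indicator_one measurableSet_Iic]
    · simp only [Set.indicator, Set.mem_Iic, Pi.one_apply]
    · exact Measurable.ite measurableSet_Iic measurable_const measurable_const
  rw [h2, ← mul_assoc]
  gcongr
  exact ofReal_le_mul_expMeasure_Iic hω hM.lamMin_pos (hM.le_rate _ _)

/-- The integrand is a supermartingale in `n`: the weight `exp (lamMax * (remaining time))` pays in
advance for the doublings still to come. At `n = 0` it equals the right-hand side. -/
theorem lintegral_prod_jump_mul_exp_le (hZ : IsRun M π K μ Z) (hM : M.Bounded lamMin lamMax)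
    (hk : k < K) (n : ℕ) :
    ∫⁻ ω, (∏ i ∈ Finset.range n, if (Z k ω).jumpTime (i + 1) ≤ M.horizon then 2 else 1) *
        ENNReal.ofReal (Real.exp (lamMax * max (M.horizon - (Z k ω).jumpTime n) 0)) ∂μ
      ≤ ENNReal.ofReal (Real.exp (lamMax * M.horizon)) := by
  induction n with
  | zero => simp [Trajectory.jumpTime, M.horizon_pos.le]
  | succ n ih =>
    refine le_trans ?_ ih
    let F : Ω → ENNReal := fun ω =>
      ∏ i ∈ Finset.range n, if (Z k ω).jumpTime (i + 1) ≤ M.horizon then 2 else 1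
    have hF : Measurable[history Z k n] F := by
      let m := history Z k n
      refine Finset.measurable_prod _ fun i hi =>
        Measurable.ite ?_ measurable_const measurable_const
      exact measurable_history_jumpTime (Finset.mem_range.1 hi) measurableSet_Iic
    let g : (ℝ × ENNReal) × ℝ → ENNReal := fun q =>
      q.1.2 * ((if q.2 ≤ M.horizon - q.1.1 then 2 else 1) *
        ENNReal.ofReal (Real.exp (lamMax * max (M.horizon - q.1.1 - q.2) 0)))
    have hg : Measurable g := by
      refine Measurable.mul (by fun_prop) (Measurable.mul
        (Measurable.ite ?_ measurable_const measurable_const) (by fun_prop))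
      exact measurableSet_le (by fun_prop) (by fun_prop)
    have hY : Measurable[history Z k n] fun ω => ((Z k ω).jumpTime n, F ω) :=
      (measurable_history_jumpTime le_rfl).prodMk hF
    have h := hZ.lintegral_hold_eq hM hk n hY hg
    have h1 : ∀ ω, g (((Z k ω).jumpTime n, F ω), (Z k ω).hold n)
        = (∏ i ∈ Finset.range (n + 1), if (Z k ω).jumpTime (i + 1) ≤ M.horizon then 2 else 1) *
          ENNReal.ofReal (Real.exp (lamMax * max (M.horizon - (Z k ω).jumpTime (n + 1)) 0)) := by
      intro ω
      rw [Finset.prod_range_succ, mul_assoc]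
      simp only [g, F, Trajectory.jumpTime, Finset.sum_range_succ, le_sub_iff_add_le', sub_sub]
    simp only [← h1]
    rw [h]
    apply lintegral_mono
    intro ω
    simp only [g]
    rw [lintegral_const_mul]
    · gcongr
      exact lintegral_expMeasure_jump_le (hM.lamMin_pos.trans_le (hM.le_rate _ _))
        (hM.rate_le _ _) _
    · exact Measurable.mul (Measurable.ite measurableSet_Iic measurable_const measurable_const)
        (by fun_prop)

/-- The exponential moment of the number of jumps before the horizon. -/
theorem lintegral_iSup_prod_jump_le (hZ : IsRun M π K μ Z) (hM : M.Bounded lamMin lamMax)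
    (hk : k < K) :
    ∫⁻ ω, ⨆ n, (∏ i ∈ Finset.range n,
        if (Z k ω).jumpTime (i + 1) ≤ M.horizon then (2 : ENNReal) else 1) ∂μ
      ≤ ENNReal.ofReal (Real.exp (lamMax * M.horizon)) := by
  rw [lintegral_iSup]
  · refine iSup_le fun n => le_trans (lintegral_mono fun ω => ?_)
      (hZ.lintegral_prod_jump_mul_exp_le hM hk n)
    refine le_mul_of_one_le_right' ?_
    rw [ENNReal.one_le_ofReal]
    exact Real.one_le_exp (mul_nonneg hM.lamMax_pos.le (le_max_right _ _))
  · intro n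
    refine Finset.measurable_prod _ fun i _ => Measurable.ite ?_ measurable_const measurable_const
    exact hZ.measurable_jumpTime hk (i + 1) measurableSet_Iic
  · intro n n' hnn ω
    refine Finset.prod_le_prod_of_subset_of_one_le' (Finset.range_mono hnn) fun i _ _ => ?_
    split_ifs <;> norm_num

end IsRun

/-! ### Pathwise bound -/

/-- Write `v = (√(N + v) - √N) * (√(N + v) + √N)`. Both roots in the second factor are at most `√(1
+ η) * √(max 1 N)`, because `N + v ≤ (1 + η) * max 1 N`. -/
theorem div_sqrt_max_one_le {v N η : ℝ} (hv : 0 ≤ v) (hvη : v ≤ η) (hN : 0 ≤ N) :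
    v / √(max 1 N) ≤ 2 * √(1 + η) * (√(N + v) - √N) := by
  have hm : 0 < √(max 1 N) := by positivity
  have h1 : √(N + v) ≤ √(1 + η) * √(max 1 N) := by
    rw [← Real.sqrt_mul (by linarith)]
    apply Real.sqrt_le_sqrt
    have h2 : N ≤ max 1 N := le_max_right _ _
    have h3 : 1 ≤ max 1 N := le_max_left _ _
    nlinarith
  have h2 : √N ≤ √(N + v) := Real.sqrt_le_sqrt (by linarith)
  have h3 : v = (√(N + v) - √N) * (√(N + v) + √N) := by
    have := Real.mul_self_sqrt hN
    have := Real.mul_self_sqrt (add_nonneg hN hv)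
    nlinarith
  rw [div_le_iff₀ hm]
  calc v = (√(N + v) - √N) * (√(N + v) + √N) := h3
    _ ≤ (√(N + v) - √N) * (2 * (√(1 + η) * √(max 1 N))) := by
      apply mul_le_mul_of_nonneg_left <;> linarith
    _ = _ := by ring

theorem sum_div_sqrt_max_one_le {v : ℕ → ℝ} {η : ℝ} {K : ℕ} (hv : ∀ k, 0 ≤ v k)
    (hvη : ∀ k < K, v k ≤ η) :
    ∑ k ∈ Finset.range K, v k / √(max 1 (∑ l ∈ Finset.range k, v l))
      ≤ 2 * √(1 + η) * √(∑ k ∈ Finset.range K, v k) := by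
  induction K with
  | zero => simp
  | succ K ih =>
    rw [Finset.sum_range_succ, Finset.sum_range_succ _ K]
    have h1 := ih fun k hk => hvη k (hk.trans (Nat.lt_succ_self K))
    have h2 := div_sqrt_max_one_le (hv K) (hvη K (Nat.lt_succ_self K))
      (Finset.sum_nonneg fun l _ => hv l : 0 ≤ ∑ l ∈ Finset.range K, v l)
    linarith

/-- With a deterministic `α`, this decouples the random `η` from the random number of jumps, so that
each can be averaged separately. -/
theorem two_mul_sqrt_mul_sqrt_le {a b α : ℝ} (ha : 0 ≤ a) (hb : 0 ≤ b) (hα : 0 < α) :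
    2 * √a * √b ≤ α * a + b / α := by
  have h1 := Real.mul_self_sqrt ha
  have h2 := Real.mul_self_sqrt hb
  have h3 : 0 ≤ (α * √a - √b) ^ 2 / α := by positivity
  have h4 : (α * √a - √b) ^ 2 / α = α * (√a * √a) + (√b * √b) / α - 2 * √a * √b := by
    field_simp; ring
  rw [h4, h1, h2] at h3
  linarith

section Pathwise

variable {S A : Type*}

theorem visitCount_eq_sum [DecidableEq S] [DecidableEq A] {T : ℕ → Trajectory S A} {H : ℝ}
    {k B : ℕ} (hB : ∀ l < k, ∀ n, B ≤ n → ¬ (T l).jumpTime (n + 1) ≤ H) (x : S) (a : A) :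
    visitCount H (fun l : Fin k => T l) x a = ∑ l ∈ Finset.range k, ∑ n ∈ Finset.range B,
      if ((T l).state n, (T l).action n) = (x, a) then
        (if (T l).jumpTime (n + 1) ≤ H then (1 : ℝ) else 0) else 0 := by
  unfold visitCount
  rw [tsum_eq_sum (s := Finset.range B), Finset.sum_comm, ← Fin.sum_univ_eq_sum_range]
  · refine Finset.sum_congr rfl fun l _ => Finset.sum_congr rfl fun n _ => ?_
    simp only [Prod.mk.injEq, ← ite_and, and_assoc]
    congr
  · intro n hn
    refine Finset.sum_eq_zero fun l _ => if_neg fun h => ?_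
    exact hB l l.2 n (by simpa using hn) h.2.2

/-- Group the jumps by pair `q`. All jumps of episode `k` at `q` carry the same weight, so each pair
yields a telescoping sum to which AM-GM applies; summing over pairs gives the factor `S A` and
recovers the total number of jumps. -/
theorem sum_jump_div_sqrt_visitCount_le [Fintype S] [Fintype A] {T : ℕ → Trajectory S A} {H : ℝ}
    {K B : ℕ} (hB : ∀ k < K, ∀ n, B ≤ n → ¬ (T k).jumpTime (n + 1) ≤ H) {η α : ℝ} (hα : 0 < α)
    (hη : ∀ k < K, ∑ n ∈ Finset.range B, (if (T k).jumpTime (n + 1) ≤ H then (1 : ℝ) else 0) ≤ η)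
    (hη0 : 0 ≤ η) :
    ∑ k ∈ Finset.range K, ∑ n ∈ Finset.range B,
        (if (T k).jumpTime (n + 1) ≤ H then (1 : ℝ) else 0) *
        (1 / √(max 1 (visitCount H (fun l : Fin k => T l) ((T k).state n) ((T k).action n))))
      ≤ Fintype.card S * Fintype.card A * α * (1 + η) +
        (∑ k ∈ Finset.range K, ∑ n ∈ Finset.range B,
          if (T k).jumpTime (n + 1) ≤ H then (1 : ℝ) else 0) / α := by
  classical
  let v : S × A → ℕ → ℝ := fun q k => ∑ n ∈ Finset.range B,
    if ((T k).state n, (T k).action n) = q then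
      (if (T k).jumpTime (n + 1) ≤ H then (1 : ℝ) else 0) else 0
  have hv : ∀ q k, 0 ≤ v q k := fun q k =>
    Finset.sum_nonneg fun n _ => by split_ifs <;> norm_num
  have hvη : ∀ q, ∀ k < K, v q k ≤ η := fun q k hk => by
    refine le_trans (Finset.sum_le_sum fun n _ => ?_) (hη k hk)
    split_ifs <;> norm_num
  have hvsum : ∀ k, ∑ q, v q k
      = ∑ n ∈ Finset.range B, if (T k).jumpTime (n + 1) ≤ H then (1 : ℝ) else 0 := by
    intro k
    simp only [v]
    rw [Finset.sum_comm]
    simp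
  have hcount : ∀ k < K, ∀ q : S × A, visitCount H (fun l : Fin k => T l) q.1 q.2
      = ∑ l ∈ Finset.range k, v q l := fun k hk q =>
    visitCount_eq_sum (fun l hl => hB l (hl.trans hk)) q.1 q.2
  have h1 : ∀ k ∈ Finset.range K,
      ∑ n ∈ Finset.range B, (if (T k).jumpTime (n + 1) ≤ H then (1 : ℝ) else 0) *
        (1 / √(max 1 (visitCount H (fun l : Fin k => T l) ((T k).state n) ((T k).action n))))
      = ∑ q, v q k / √(max 1 (∑ l ∈ Finset.range k, v q l)) := by
    intro k hk
    have h2 : ∀ q, v q k / √(max 1 (∑ l ∈ Finset.range k, v q l))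
        = ∑ n ∈ Finset.range B, if ((T k).state n, (T k).action n) = q then
          (if (T k).jumpTime (n + 1) ≤ H then (1 : ℝ) else 0) *
            (1 / √(max 1 (visitCount H (fun l : Fin k => T l) q.1 q.2))) else 0 := by
      intro q
      rw [hcount k (Finset.mem_range.1 hk) q, div_eq_mul_one_div, Finset.sum_mul]
      refine Finset.sum_congr rfl fun n _ => ?_
      rw [ite_mul, zero_mul]
    simp only [h2]
    rw [Finset.sum_comm]
    simp
  rw [Finset.sum_congr rfl h1, Finset.sum_comm]
  calc _ ≤ ∑ q : S × A, (α * (1 + η) + (∑ k ∈ Finset.range K, v q k) / α) := by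
        refine Finset.sum_le_sum fun q _ => (sum_div_sqrt_max_one_le (hv q) (hvη q)).trans ?_
        exact two_mul_sqrt_mul_sqrt_le (by linarith) (Finset.sum_nonneg fun k _ => hv q k) hα
    _ = _ := by
        rw [Finset.sum_add_distrib, ← Finset.sum_div, Finset.sum_comm]
        simp only [hvsum]
        simp
        ring

end Pathwise

/-! ### Numerical inequalities -/

/-- With `w = √(1 + u)`, the inequality `log w ≤ sinh (log w) = (w - 1 / w) / 2` reads `log (u + 1)
≤ u / w`. -/
theorem sqrt_one_add_le_div_log {u : ℝ} (hu : 0 < u) : √(1 + u) ≤ u / Real.log (u + 1) := by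
  have hw : 1 < √(1 + u) := by
    rw [Real.lt_sqrt (by norm_num)]; linarith
  have hlog : 0 < Real.log (u + 1) := Real.log_pos (by linarith)
  have h1 : Real.log √(1 + u) ≤ Real.sinh (Real.log √(1 + u)) :=
    Real.self_le_sinh_iff.2 (Real.log_pos hw).le
  rw [Real.sinh_log (by linarith), Real.log_sqrt (by linarith), add_comm 1 u] at h1
  rw [add_comm 1 u] at hw ⊢
  have h2 := Real.mul_self_sqrt (show 0 ≤ u + 1 by linarith)
  have h3 : √(u + 1) * (√(u + 1))⁻¹ = 1 := mul_inv_cancel₀ (by linarith)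
  rw [le_div_iff₀ hlog]
  nlinarith

/-- This is the tangent line of `exp` at `b`, evaluated at `n * log 2`. Being linear in `w`, it
survives expectation and gives `b / log 2` once the mean of `w` is at most `exp b`. -/
theorem le_of_two_rpow_le {n b w : ℝ} (h : (2 : ℝ) ^ n ≤ w) :
    n ≤ (b - 1 + w / Real.exp b) / Real.log 2 := by
  have hl : 0 < Real.log 2 := Real.log_pos (by norm_num)
  rw [le_div_iff₀ hl]
  have h1 := Real.add_one_le_exp (n * Real.log 2 - b)
  have h2 : Real.exp (n * Real.log 2 - b) = 2 ^ n / Real.exp b := by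
    rw [Real.exp_sub, Real.rpow_def_of_pos (by norm_num), mul_comm]
  have h3 : (2 : ℝ) ^ n / Real.exp b ≤ w / Real.exp b := by gcongr
  linarith

/-- The constant `3` comes from `1 / log 2 < 1.45`: the left side is at most `(1.45 + 2.9 c) * √(1 +
u)`. -/
theorem regret_const_le {u c : ℝ} (hu : 0 < u) (hc : 0 ≤ c) :
    (1 + (u + c) / Real.log 2) / √(1 + u) + √(1 + u) * c / Real.log 2
      ≤ 3 * ((c + 1) * u / Real.log (u + 1)) := by
  have hl := Real.log_two_gt_d9
  have hs : 1 ≤ √(1 + u) := by rw [Real.one_le_sqrt]; linarith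
  have h1 := Real.mul_self_sqrt (show 0 ≤ 1 + u by linarith)
  have h2 : ∀ z : ℝ, 0 ≤ z → z / Real.log 2 ≤ 1.45 * z := by
    intro z hz
    rw [div_le_iff₀ (by linarith)]
    nlinarith
  have h3 : (1 + (u + c) / Real.log 2) / √(1 + u) ≤ 1.45 * √(1 + u) + 1.45 * c * √(1 + u) := by
    rw [div_le_iff₀ (by linarith)]
    have := h2 (u + c) (by linarith)
    have : 0 ≤ c * u := by positivity
    nlinarith
  have h4 := h2 (√(1 + u) * c) (by positivity)
  have h5 := mul_le_mul_of_nonneg_left (sqrt_one_add_le_div_log hu) (show 0 ≤ c + 1 by linarith)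
  rw [mul_div_assoc (c + 1)]
  have h6 : 0 ≤ c * √(1 + u) := by positivity
  nlinarith

/-! ### From the exponential moment to the expected sum over observed jumps -/

theorem exists_forall_ge_not_of_iSup_prod_ne_top {p : ℕ → Prop} [DecidablePred p]
    (h : ⨆ n, (∏ i ∈ Finset.range n, if p i then (2 : ENNReal) else 1) ≠ ⊤) :
    ∃ B, ∀ n, B ≤ n → ¬ p n := by
  have hfin : {i | p i}.Finite := by
    by_contra hinf
    obtain ⟨N, hN⟩ := ENNReal.exists_nat_gt h
    obtain ⟨t, htp, htc⟩ := Set.Infinite.exists_subset_card_eq hinf N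
    obtain ⟨n, hn⟩ := t.exists_nat_subset_range
    have h1 : (2 : ENNReal) ^ N ≤ ∏ i ∈ Finset.range n, if p i then (2 : ENNReal) else 1 := by
      refine le_trans (le_of_eq ?_) (Finset.prod_le_prod_of_subset_of_one_le' hn fun i _ _ => ?_)
      · rw [Finset.prod_congr rfl fun i hi => if_pos (show p i from htp hi), Finset.prod_const, htc]
      · split_ifs <;> norm_num
    have h2 : (N : ENNReal) ≤ 2 ^ N := by exact_mod_cast Nat.lt_two_pow_self.le
    exact absurd (hN.trans_le (h2.trans h1)) (not_lt.2 (le_iSup (fun n =>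
      ∏ i ∈ Finset.range n, if p i then (2 : ENNReal) else 1) n))
  obtain ⟨B, hB⟩ := hfin.bddAbove
  refine ⟨B + 1, fun n hn hp => ?_⟩
  have := hB hp
  omega

theorem two_rpow_sum_le_toReal_iSup_prod {p : ℕ → Prop} [DecidablePred p]
    (h : ⨆ n, (∏ i ∈ Finset.range n, if p i then (2 : ENNReal) else 1) ≠ ⊤) (B : ℕ) :
    (2 : ℝ) ^ (∑ i ∈ Finset.range B, if p i then (1 : ℝ) else 0)
      ≤ (⨆ n, (∏ i ∈ Finset.range n, if p i then (2 : ENNReal) else 1)).toReal := by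
  have h1 : (2 : ℝ) ^ (∑ i ∈ Finset.range B, if p i then (1 : ℝ) else 0)
      = (∏ i ∈ Finset.range B, if p i then (2 : ENNReal) else 1).toReal := by
    rw [Real.rpow_sum_of_pos (by norm_num), ENNReal.toReal_prod]
    refine Finset.prod_congr rfl fun i _ => ?_
    split_ifs <;> simp
  rw [h1]
  exact ENNReal.toReal_mono h (le_iSup (fun n =>
    ∏ i ∈ Finset.range n, if p i then (2 : ENNReal) else 1) B)

namespace IsRun

variable {S A Ω : Type*} [Fintype S] [Fintype A] [MeasurableSpace S] [DiscreteMeasurableSpace S]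
  [MeasurableSpace A] [DiscreteMeasurableSpace A] [MeasurableSpace Ω] {μ : Measure Ω}
  [IsProbabilityMeasure μ] {M : CTMDP S A} {lamMin lamMax : ℝ} {K : ℕ} {π : Algorithm S A}
  {Z : ℕ → Ω → Trajectory S A}

theorem ae_iSup_prod_jump_ne_top (hZ : IsRun M π K μ Z) (hM : M.Bounded lamMin lamMax) :
    ∀ᵐ ω ∂μ, ∀ k < K, (⨆ n, (∏ i ∈ Finset.range n,
      if (Z k ω).jumpTime (i + 1) ≤ M.horizon then (2 : ENNReal) else 1)) ≠ ⊤ := by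
  refine ae_all_iff.2 fun k => ?_
  by_cases hk : k < K
  · have hm : Measurable fun ω => ⨆ n, (∏ i ∈ Finset.range n,
        if (Z k ω).jumpTime (i + 1) ≤ M.horizon then (2 : ENNReal) else 1) :=
      Measurable.iSup fun n => Finset.measurable_prod _ fun i _ =>
        Measurable.ite (hZ.measurable_jumpTime hk (i + 1) measurableSet_Iic)
          measurable_const measurable_const
    filter_upwards [ae_lt_top hm ((hZ.lintegral_iSup_prod_jump_le hM hk).trans_lt
      ENNReal.ofReal_lt_top).ne] with ω hω _
    exact hω.ne
  · exact Filter.Eventually.of_forall fun ω h => absurd h hk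

end IsRun

/-- Two tangent points are used. For the maximum over episodes, `W k` is bounded by the sum of all
`W`, and `b = u + c` absorbs the resulting factor `K = exp u`. For the total number of jumps, `b =
c` is used in each episode. -/
theorem sum_jump_div_sqrt_visitCount_le_exp_moment {S A : Type*} [Fintype S] [Fintype A]
    [Nonempty S] [Nonempty A] {T : ℕ → Trajectory S A} {H : ℝ} {K B : ℕ} (hK : 0 < K)
    (hB : ∀ k < K, ∀ n, B ≤ n → ¬ (T k).jumpTime (n + 1) ≤ H) {u : ℝ} (c : ℝ)
    (hu : u = Real.log K) {W : ℕ → ℝ}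
    (hW : ∀ k < K, (2 : ℝ) ^ (∑ n ∈ Finset.range B,
      if (T k).jumpTime (n + 1) ≤ H then (1 : ℝ) else 0) ≤ W k) :
    ∑ k ∈ Finset.range K, ∑ n ∈ Finset.range B,
        (if (T k).jumpTime (n + 1) ≤ H then (1 : ℝ) else 0) *
        (1 / √(max 1 (visitCount H (fun l : Fin k => T l) ((T k).state n) ((T k).action n))))
      ≤ √(Fintype.card S * Fintype.card A * K) *
          ((1 + (u + c - 1) / Real.log 2) / √(1 + u) + √(1 + u) * (c - 1) / Real.log 2) +
        √(Fintype.card S * Fintype.card A * K) * (1 / √(1 + u) + √(1 + u)) /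
          (K * Real.exp c * Real.log 2) * ∑ k ∈ Finset.range K, W k := by
  have hK0 : (0 : ℝ) < K := by exact_mod_cast hK
  have hu0 : 0 ≤ u := by rw [hu]; exact Real.log_nonneg (by exact_mod_cast hK)
  have hl : 0 < Real.log 2 := Real.log_pos (by norm_num)
  have hS : (0 : ℝ) < Fintype.card S := by exact_mod_cast Fintype.card_pos
  have hA : (0 : ℝ) < Fintype.card A := by exact_mod_cast Fintype.card_pos
  have hexp : Real.exp (u + c) = K * Real.exp c := by rw [Real.exp_add, hu, Real.exp_log hK0]
  have hs : 0 < √(1 + u) := Real.sqrt_pos.2 (by linarith)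
  have hW0 : ∀ k ∈ Finset.range K, 0 ≤ W k := fun k hk =>
    le_trans (by positivity) (hW k (Finset.mem_range.1 hk))
  have hη : ∀ k < K, ∑ n ∈ Finset.range B, (if (T k).jumpTime (n + 1) ≤ H then (1 : ℝ) else 0)
      ≤ (u + c - 1 + (∑ k ∈ Finset.range K, W k) / Real.exp (u + c)) / Real.log 2 := fun k hk =>
    le_of_two_rpow_le ((hW k hk).trans
      (Finset.single_le_sum (f := W) hW0 (Finset.mem_range.2 hk)))
  -- Since `u + c - 1` may be negative, nonnegativity of this bound is read off from the jump count
  -- of episode `0`.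
  have hη0 := (Finset.sum_nonneg fun n _ => by split_ifs <;> norm_num : (0 : ℝ) ≤
    ∑ n ∈ Finset.range B, (if (T 0).jumpTime (n + 1) ≤ H then (1 : ℝ) else 0)).trans (hη 0 hK)
  set R := √(Fintype.card S * Fintype.card A * K)
  have hR0 : 0 < R := Real.sqrt_pos.2 (by positivity)
  have hRR : R * R = Fintype.card S * Fintype.card A * K := Real.mul_self_sqrt (by positivity)
  -- This `α = √(K / (S A (1 + u)))` balances `S A α (1 + u)` against `K / α`.
  have hα : 0 < R / (Fintype.card S * Fintype.card A * √(1 + u)) := by positivity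
  refine (sum_jump_div_sqrt_visitCount_le hB hα hη hη0).trans ?_
  have hN : ∑ k ∈ Finset.range K, ∑ n ∈ Finset.range B,
        (if (T k).jumpTime (n + 1) ≤ H then (1 : ℝ) else 0)
      ≤ (K * (c - 1) + (∑ k ∈ Finset.range K, W k) / Real.exp c) / Real.log 2 := by
    calc _ ≤ ∑ k ∈ Finset.range K, (c - 1 + W k / Real.exp c) / Real.log 2 :=
          Finset.sum_le_sum fun k hk => le_of_two_rpow_le (hW k (Finset.mem_range.1 hk))
      _ = _ := by
        rw [← Finset.sum_div, Finset.sum_add_distrib, ← Finset.sum_div, Finset.sum_const,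
          Finset.card_range, nsmul_eq_mul]
  calc _ ≤ Fintype.card S * Fintype.card A * (R / (Fintype.card S * Fintype.card A * √(1 + u))) *
          (1 + (u + c - 1 + (∑ k ∈ Finset.range K, W k) / Real.exp (u + c)) / Real.log 2) +
        (K * (c - 1) + (∑ k ∈ Finset.range K, W k) / Real.exp c) / Real.log 2 /
          (R / (Fintype.card S * Fintype.card A * √(1 + u))) := by gcongr
    _ = _ := by
      rw [hexp]
      have h1 : Fintype.card S * Fintype.card A * (R / (Fintype.card S * Fintype.card A * √(1 + u)))
          = R / √(1 + u) := by field_simp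
      have h2 : ∀ z : ℝ, z / (R / (Fintype.card S * Fintype.card A * √(1 + u)))
          = z * (R * √(1 + u) / K) := by
        intro z
        field_simp
        rw [pow_two, hRR]
        ring
      rw [h1, h2]
      field_simp
      ring

namespace IsRun

variable {S A Ω : Type*} [Fintype S] [Fintype A] [MeasurableSpace S] [DiscreteMeasurableSpace S]
  [MeasurableSpace A] [DiscreteMeasurableSpace A] [MeasurableSpace Ω] {μ : Measure Ω}
  [IsProbabilityMeasure μ] {M : CTMDP S A} {lamMin lamMax : ℝ} {K : ℕ} {π : Algorithm S A}
  {Z : ℕ → Ω → Trajectory S A}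

/-- The expected sum of the count bonuses over all observed jumps. -/
theorem lintegral_sum_jump_div_sqrt_visitCount_le (hZ : IsRun M π K μ Z)
    (hM : M.Bounded lamMin lamMax) (hK : 2 ≤ K) :
    ∫⁻ ω, ∑ k ∈ Finset.range K, ∑' n : ℕ,
        (if (Z k ω).jumpTime (n + 1) ≤ M.horizon then 1 else 0) *
        ENNReal.ofReal (1 / √(max 1 (visitCount M.horizon (past Z k ω)
          ((Z k ω).state n) ((Z k ω).action n)))) ∂μ
      ≤ ENNReal.ofReal (3 * √(Fintype.card S * Fintype.card A * K) *
        ((lamMax * M.horizon + 1) * Real.log K / Real.log (Real.log K + 1))) := by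
  have hK0 : (0 : ℝ) < K := by exact_mod_cast (by omega : 0 < K)
  have hlogK : 0 < Real.log K := Real.log_pos (by exact_mod_cast hK)
  have hl : 0 < Real.log 2 := Real.log_pos (by norm_num)
  have hc : 0 ≤ lamMax * M.horizon := mul_nonneg hM.lamMax_pos.le M.horizon_pos.le
  have ⟨ω₀⟩ : Nonempty Ω := nonempty_of_isProbabilityMeasure μ
  have hneS : Nonempty S := ⟨M.x₀⟩
  have hneA : Nonempty A := ⟨(Z 0 ω₀).action 0⟩
  let W : ℕ → Ω → ENNReal := fun k ω => ⨆ n, (∏ i ∈ Finset.range n,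
    if (Z k ω).jumpTime (i + 1) ≤ M.horizon then (2 : ENNReal) else 1)
  have hWm : ∀ k ∈ Finset.range K, Measurable (W k) := fun k hk =>
    Measurable.iSup fun n => Finset.measurable_prod _ fun i _ =>
      Measurable.ite (hZ.measurable_jumpTime (Finset.mem_range.1 hk) (i + 1) measurableSet_Iic)
        measurable_const measurable_const
  have hWle : ∀ k ∈ Finset.range K,
      ∫⁻ ω, W k ω ∂μ ≤ ENNReal.ofReal (Real.exp (lamMax * M.horizon)) :=
    fun k hk => hZ.lintegral_iSup_prod_jump_le hM (Finset.mem_range.1 hk)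
  have hWint : ∀ k ∈ Finset.range K, Integrable (fun ω => (W k ω).toReal) μ := fun k hk =>
    integrable_toReal_of_lintegral_ne_top (hWm k hk).aemeasurable
      ((hWle k hk).trans_lt ENNReal.ofReal_lt_top).ne
  have hWI : ∀ k ∈ Finset.range K, ∫ ω, (W k ω).toReal ∂μ ≤ Real.exp (lamMax * M.horizon) := by
    intro k hk
    rw [integral_toReal (hWm k hk).aemeasurable
      (ae_lt_top (hWm k hk) ((hWle k hk).trans_lt ENNReal.ofReal_lt_top).ne)]
    exact ENNReal.toReal_le_of_le_ofReal (Real.exp_nonneg _) (hWle k hk)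
  set c := lamMax * M.horizon
  set u := Real.log K with hu
  set R := √(Fintype.card S * Fintype.card A * K)
  set P := R * ((1 + (u + c - 1) / Real.log 2) / √(1 + u) + √(1 + u) * (c - 1) / Real.log 2)
  set Q := R * (1 / √(1 + u) + √(1 + u)) / (K * Real.exp c * Real.log 2)
  have hs : 0 < √(1 + u) := Real.sqrt_pos.2 (by linarith)
  have key : ∀ᵐ ω ∂μ, 0 ≤ P + Q * ∑ k ∈ Finset.range K, (W k ω).toReal ∧
      ∑ k ∈ Finset.range K, ∑' n : ℕ,
        (if (Z k ω).jumpTime (n + 1) ≤ M.horizon then 1 else 0) *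
        ENNReal.ofReal (1 / √(max 1 (visitCount M.horizon (past Z k ω)
          ((Z k ω).state n) ((Z k ω).action n))))
      ≤ ENNReal.ofReal (P + Q * ∑ k ∈ Finset.range K, (W k ω).toReal) := by
    filter_upwards [hZ.ae_iSup_prod_jump_ne_top hM] with ω hω
    have hB' : ∃ B, ∀ k < K, ∀ n, B ≤ n → ¬ (Z k ω).jumpTime (n + 1) ≤ M.horizon := by
      have h : ∀ k, ∃ B, k < K → ∀ n, B ≤ n → ¬ (Z k ω).jumpTime (n + 1) ≤ M.horizon := fun k => by
        by_cases hk : k < K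
        · obtain ⟨B, hB⟩ := exists_forall_ge_not_of_iSup_prod_ne_top (hω k hk)
          exact ⟨B, fun _ => hB⟩
        · exact ⟨0, fun h => absurd h hk⟩
      choose B hB using h
      exact ⟨(Finset.range K).sup B, fun k hk n hn =>
        hB k hk n ((Finset.le_sup (Finset.mem_range.2 hk)).trans hn)⟩
    obtain ⟨B, hB⟩ := hB'
    -- The cutoff `B` depends on `ω`, but the resulting bound does not involve it.
    have h1 := sum_jump_div_sqrt_visitCount_le_exp_moment (T := fun k => Z k ω)
      (by omega : 0 < K) hB c hu (W := fun k => (W k ω).toReal)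
      (fun k hk => two_rpow_sum_le_toReal_iSup_prod (hω k hk) B)
    refine ⟨le_trans ?_ h1, le_trans (le_of_eq ?_) (ENNReal.ofReal_le_ofReal h1)⟩
    · refine Finset.sum_nonneg fun k _ => Finset.sum_nonneg fun n _ => mul_nonneg ?_ (by positivity)
      split_ifs <;> norm_num
    · rw [ENNReal.ofReal_sum_of_nonneg]
      · refine Finset.sum_congr rfl fun k hk => ?_
        rw [ENNReal.ofReal_sum_of_nonneg, tsum_eq_sum (s := Finset.range B)]
        · refine Finset.sum_congr rfl fun n _ => ?_
          split_ifs
          · simp only [one_mul]; rfl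
          · simp
        · intro n hn
          rw [if_neg (hB k (Finset.mem_range.1 hk) n (by simpa using hn)), zero_mul]
        · intro n _
          refine mul_nonneg ?_ (by positivity)
          split_ifs <;> norm_num
      · refine fun k _ => Finset.sum_nonneg fun n _ => mul_nonneg ?_ (by positivity)
        split_ifs <;> norm_num
  have hsum : Integrable (fun ω => ∑ k ∈ Finset.range K, (W k ω).toReal) μ :=
    integrable_finsetSum _ hWint
  refine (lintegral_mono_ae (key.mono fun ω h => h.2)).trans ?_
  have hint : Integrable (fun ω => P + Q * ∑ k ∈ Finset.range K, (W k ω).toReal) μ :=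
    (integrable_const P).add (hsum.const_mul Q)
  rw [← ofReal_integral_eq_lintegral_ofReal hint (key.mono fun ω h => h.1)]
  apply ENNReal.ofReal_le_ofReal
  rw [integral_add (integrable_const P) (hsum.const_mul Q), integral_const_mul Q,
    integral_finsetSum _ hWint, integral_const, probReal_univ, one_smul]
  have hQ0 : 0 ≤ Q := by positivity
  calc P + Q * ∑ k ∈ Finset.range K, ∫ ω, (W k ω).toReal ∂μ
      ≤ P + Q * ∑ k ∈ Finset.range K, Real.exp c := by
        gcongr with k hk
        exact hWI k hk
    -- The contribution `Q * K * exp c` cancels the two `-1` terms left in `P` by the tangent lines.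
    _ = R * ((1 + (u + c) / Real.log 2) / √(1 + u) + √(1 + u) * c / Real.log 2) := by
        simp only [Finset.sum_const, Finset.card_range, nsmul_eq_mul, P, Q]
        field_simp
        ring
    _ ≤ R * (3 * ((c + 1) * u / Real.log (u + 1))) := by
        gcongr
        exact regret_const_le hlogK hc
    _ = _ := by ring

end IsRun

end EpisodicCTMDP

/-! ### Replacing remaining time by observed jumps in the whole sum -/

theorem mainTheorem4
    {S A Ω : Type*} [Fintype S] [Fintype A]
    [MeasurableSpace S] [DiscreteMeasurableSpace S]
    [MeasurableSpace A] [DiscreteMeasurableSpace A]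
    [MeasurableSpace Ω] (μ : MeasureTheory.Measure Ω) [MeasureTheory.IsProbabilityMeasure μ]
    (M : EpisodicCTMDP.CTMDP S A) (lamMin lamMax : ℝ) (hM : M.Bounded lamMin lamMax)
    (K : ℕ) (hK : 2 ≤ K)
    (delta : ℝ) (hdelta : delta ∈ Set.Ioo (0 : ℝ) 1)
    (eps : ℕ → ℝ) (heps : ∀ k, eps k ∈ Set.Ioo (0 : ℝ) 1)
    (π : EpisodicCTMDP.Algorithm S A)
    (hπ : EpisodicCTMDP.IsCTUCBVI
      { K := K, H := M.horizon, lamMax := lamMax, reward := M.reward,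
        delta := delta, eps := eps } π)
    (Z : ℕ → Ω → EpisodicCTMDP.Trajectory S A)
    (hZ : EpisodicCTMDP.IsRun M π K μ Z) :
    ∫⁻ ω, ∑ k ∈ Finset.range K, ∑' m : ℕ,
        ENNReal.ofReal
          (max (M.horizon - (Z k ω).jumpTime m) 0 /
            √(max 1 (EpisodicCTMDP.visitCount M.horizon (EpisodicCTMDP.past Z k ω)
              ((Z k ω).state m) ((Z k ω).action m)))) ∂μ
      ≤ ENNReal.ofReal
          (3 * (M.horizon + 1 / lamMin) * √(Fintype.card S * Fintype.card A * K) *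
            ((lamMax * M.horizon + 1) * Real.log K / Real.log (Real.log K + 1))) := by
  have hlMin := hM.lamMin_pos
  have hH := M.horizon_pos
  let F : ℕ → ℕ → Ω → ENNReal := fun k n ω => ENNReal.ofReal (1 / √(max 1
    (EpisodicCTMDP.visitCount M.horizon (EpisodicCTMDP.past Z k ω)
      ((Z k ω).state n) ((Z k ω).action n))))
  -- The weight depends only on earlier episodes and on the current pair, so it is known before the
  -- holding time is drawn.
  have hF : ∀ k n, Measurable[EpisodicCTMDP.history Z k n] (F k n) := fun k n =>
    ((measurable_const.max (EpisodicCTMDP.measurable_history_visitCount_current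
      M.horizon)).sqrt.const_div 1).ennreal_ofReal
  have hJ : ∀ k ∈ Finset.range K, ∀ n, Measurable fun ω => (Z k ω).jumpTime n :=
    fun k hk n => hZ.measurable_jumpTime (Finset.mem_range.1 hk) n
  have hF0 : ∀ k ∈ Finset.range K, ∀ n, Measurable (F k n) := fun k hk n =>
    (hF k n).mono (hZ.history_le (Finset.mem_range.1 hk) n) le_rfl
  have hm1 : ∀ k ∈ Finset.range K, ∀ n, Measurable fun ω =>
      ENNReal.ofReal (max (M.horizon - (Z k ω).jumpTime n) 0) * F k n ω := fun k hk n =>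
    (((hJ k hk n).const_sub _).max measurable_const).ennreal_ofReal.mul (hF0 k hk n)
  have hm2 : ∀ k ∈ Finset.range K, ∀ n, Measurable fun ω =>
      (if (Z k ω).jumpTime (n + 1) ≤ M.horizon then 1 else 0) * F k n ω := fun k hk n =>
    (Measurable.ite (hJ k hk (n + 1) measurableSet_Iic) measurable_const measurable_const).mul
      (hF0 k hk n)
  have hsplit : ∀ k n ω, ENNReal.ofReal (max (M.horizon - (Z k ω).jumpTime n) 0 /
      √(max 1 (EpisodicCTMDP.visitCount M.horizon (EpisodicCTMDP.past Z k ω)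
        ((Z k ω).state n) ((Z k ω).action n))))
      = ENNReal.ofReal (max (M.horizon - (Z k ω).jumpTime n) 0) * F k n ω := by
    intro k n ω
    rw [← ENNReal.ofReal_mul (le_max_right _ _), mul_one_div]
  simp only [hsplit]
  calc ∫⁻ ω, ∑ k ∈ Finset.range K, ∑' n : ℕ,
        ENNReal.ofReal (max (M.horizon - (Z k ω).jumpTime n) 0) * F k n ω ∂μ
      = ∑ k ∈ Finset.range K, ∑' n : ℕ,
        ∫⁻ ω, ENNReal.ofReal (max (M.horizon - (Z k ω).jumpTime n) 0) * F k n ω ∂μ := by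
        rw [MeasureTheory.lintegral_finsetSum' _ fun k hk =>
          AEMeasurable.tsum fun n => (hm1 k hk n).aemeasurable]
        exact Finset.sum_congr rfl fun k hk =>
          MeasureTheory.lintegral_tsum fun n => (hm1 k hk n).aemeasurable
    _ ≤ ∑ k ∈ Finset.range K, ∑' n : ℕ, ENNReal.ofReal (M.horizon + 1 / lamMin) *
        ∫⁻ ω, (if (Z k ω).jumpTime (n + 1) ≤ M.horizon then 1 else 0) * F k n ω ∂μ :=
        Finset.sum_le_sum fun k hk => ENNReal.tsum_le_tsum fun n =>
          hZ.lintegral_remaining_mul_le hM (Finset.mem_range.1 hk) n (hF k n)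
    _ = ENNReal.ofReal (M.horizon + 1 / lamMin) * ∫⁻ ω, ∑ k ∈ Finset.range K, ∑' n : ℕ,
        (if (Z k ω).jumpTime (n + 1) ≤ M.horizon then 1 else 0) * F k n ω ∂μ := by
        rw [MeasureTheory.lintegral_finsetSum' _ fun k hk =>
          AEMeasurable.tsum fun n => (hm2 k hk n).aemeasurable, Finset.mul_sum]
        refine Finset.sum_congr rfl fun k hk => ?_
        rw [MeasureTheory.lintegral_tsum fun n => (hm2 k hk n).aemeasurable, ENNReal.tsum_mul_left]
    _ ≤ _ := by
        refine (mul_le_mul' le_rfl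
          (hZ.lintegral_sum_jump_div_sqrt_visitCount_le hM hK)).trans (le_of_eq ?_)
        rw [← ENNReal.ofReal_mul (by positivity)]
        congr 1
        ring
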